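/- Let $A$ be a JBW-algebra, that is: $A$ is a real unital Jordan algebra with product $\circ$ which is a Banach space for a norm satisfying $\|a\circ b\|\le\|a\|\,\|b\|$, $\|a^2\|=\|a\|^2$ and $\|a^2\|\le\|a^2+b^2\|$ for all $a,b\in A$, and $A$ is isometrically isomorphic to the dual of some Banach space. Order $A$ by the cone $A^+=\{a^2:a\in A\}$, and for $x\in A$ let $|x|$ be the unique element of $A^+$ with $|x|^2=x^2$. Let $\tau:A^+\to[0,\infty]$ be a faithful semi-finite normal trace. This means: $\tau(a+\lambda b)=\tau(a)+\lambda\tau(b)$ for $a,b\in A^+$, $\lambda\ge 0$ (with $0\cdot\infty=0$); $\tau(2s\circ(s\circ a)-s^2\circ a)=\tau(a)$ for all $a\in A^+$ and all $s\in A$ with $s^2=\mathbf 1$; $\tau(a)>0$ for $0\ne a\in A^+$; $\tau(\sup_\alpha x_\alpha)=\sup_\alpha\tau(x_\alpha)$ for every increasing net $(x_\alpha)$ in $A^+$ that is bounded above; and there is a net in $A^+$ increasing to $\mathbf 1$ all of whose members have finite trace. Let $L_1(A,\tau)$ be the completion of $A_1=\{x\in A:\tau(|x|)<\infty\}$ in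 the norm $\|x\|_1=\tau(|x|)$, ordered by the closure of $A_1\cap A^+$. A positive contraction of $L_1(A,\tau)$ is a linear operator $T:L_1(A,\tau)\to L_1(A,\tau)$ with $Tx\ge 0$ for all $x\ge 0$ and operator norm $\|T\|\le 1$; write $T\le S$ if $Tx\le Sx$ for all $x\ge 0$. Let $T,S:L_1(A,\tau)\to L_1(A,\tau)$ be two positive contractions such that $T\le S$. If $\|S-T\|<1$, then $\|S^n-T^n\|<1$ for every integer $n\ge 1$. -/

import Mathlib

open scoped ENNReal NNReal

universe u

/-- A (unital) JB-algebra: a real unital commutative algebra satisfying the Jordan identity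
`a² ∘ (b ∘ a) = (a² ∘ b) ∘ a`, which is a Banach space for a submultiplicative norm with
`‖a²‖ = ‖a‖²` and `‖a²‖ ≤ ‖a² + b²‖`. The Jordan product `a ∘ b` is written `a * b`. -/
class JBAlgebra (A : Type u) extends Norm A, NonAssocCommRing A, MetricSpace A, Module ℝ A where
  dist_eq : ∀ a b : A, dist a b = ‖-a + b‖
  norm_smul_le : ∀ (r : ℝ) (a : A), ‖r • a‖ ≤ ‖r‖ * ‖a‖
  complete : CompleteSpace A
  smul_mul : ∀ (r : ℝ) (a b : A), (r • a) * b = r • (a * b)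
  jordan : ∀ a b : A, (a * a) * (b * a) = ((a * a) * b) * a
  norm_mul_le : ∀ a b : A, ‖a * b‖ ≤ ‖a‖ * ‖b‖
  norm_sq : ∀ a : A, ‖a * a‖ = ‖a‖ ^ 2
  norm_sq_le : ∀ a b : A, ‖a * a‖ ≤ ‖a * a + b * b‖

namespace JBAlgebra

section Basic

variable {A : Type u} [JBAlgebra A]

instance : NormedAddCommGroup A :=
  { (inferInstance : Norm A), (inferInstance : AddCommGroup A),
    (inferInstance : MetricSpace A) with
    dist_eq := JBAlgebra.dist_eq }

instance : NormedSpace ℝ A where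
  norm_smul_le := JBAlgebra.norm_smul_le

instance : CompleteSpace A := JBAlgebra.complete

/-- The order of a JB-algebra: `a ≤ b` iff `b - a` is a square. -/
instance : LE A := ⟨fun a b => ∃ c : A, b - a = c * c⟩

variable (A) in
/-- The positive cone `A⁺ = {a² : a ∈ A}`. -/
def posCone : Set A := {a | ∃ c : A, a = c * c}

theorem zero_le_iff (a : A) : 0 ≤ a ↔ a ∈ posCone A := by
  change (∃ c : A, a - 0 = c * c) ↔ _
  rw [sub_zero]
  rfl

variable (A) in
/-- A JBW-algebra is a JB-algebra which is isometrically isomorphic, as a Banach space, to the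
dual of a Banach space. -/
def IsJBW : Prop :=
  ∃ (N : Type u) (_ : NormedAddCommGroup N) (_ : NormedSpace ℝ N) (_ : CompleteSpace N),
    Nonempty (A ≃ₗᵢ[ℝ] StrongDual ℝ N)

/-- The quadratic operator `U_s x = 2 s ∘ (s ∘ x) - s² ∘ x`. -/
def U (s x : A) : A := (2 : ℝ) • (s * (s * x)) - (s * s) * x

open Classical in
/-- The modulus `|x|`: the (unique) positive element whose square is `x²`. -/
noncomputable def modulus (x : A) : A :=
  if h : ∃ y ∈ posCone A, y * y = x * x then h.choose else 0

/-- `modulus x` is indeed positive. -/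
theorem modulus_mem_posCone (x : A) : modulus x ∈ posCone A := by
  unfold modulus
  split_ifs with h
  · exact h.choose_spec.1
  · exact ⟨0, by simp⟩

/-- A trace `τ : A⁺ → [0, ∞]`. It is encoded as a function on all of `A`, whose values outside
`A⁺` are never used. -/
structure IsTrace (τ : A → ℝ≥0∞) : Prop where
  add_smul : ∀ a ∈ posCone A, ∀ b ∈ posCone A, ∀ r : ℝ≥0,
    τ (a + (r : ℝ) • b) = τ a + (r : ℝ≥0∞) * τ b
  symm_invariant : ∀ a ∈ posCone A, ∀ s : A, s * s = 1 → τ (U s a) = τ a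

/-- A faithful trace is strictly positive on nonzero positive elements. -/
def IsFaithful (τ : A → ℝ≥0∞) : Prop :=
  ∀ a ∈ posCone A, a ≠ 0 → 0 < τ a

/-- A normal trace preserves the suprema of increasing nets in `A⁺`. (Increasing nets are given by
their ranges, the nonempty upward directed sets; each such set is an increasing net indexed by
itself.) -/
def IsNormal (τ : A → ℝ≥0∞) : Prop :=
  ∀ D : Set A, D ⊆ posCone A → D.Nonempty → DirectedOn (· ≤ ·) D →
    ∀ a : A, IsLUB D a → τ a = ⨆ d ∈ D, τ d

/-- A trace is semi-finite if some net of positive elements of finite trace increases to `1`. -/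
def IsSemifinite (τ : A → ℝ≥0∞) : Prop :=
  ∃ D : Set A, D ⊆ posCone A ∧ D.Nonempty ∧ DirectedOn (· ≤ ·) D ∧ IsLUB D 1 ∧ ∀ d ∈ D, τ d < ∞

/-- The set `A₁ = {x ∈ A : τ(|x|) < ∞}`. -/
def A₁ (τ : A → ℝ≥0∞) : Set A := {x | τ (modulus x) < ∞}

end Basic

section L1

variable {A : Type u} [JBAlgebra A] (τ : A → ℝ≥0∞)

/-- The vector space `A₁`. For a faithful semi-finite normal trace `A₁` is a linear subspace, so
the linear span below is `A₁` itself; the span makes the definition meaningful without that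
fact. -/
def A₁Space : Type u := Submodule.span ℝ (A₁ τ)

noncomputable instance : AddCommGroup (A₁Space τ) :=
  inferInstanceAs (AddCommGroup (Submodule.span ℝ (A₁ τ)))

noncomputable instance : Module ℝ (A₁Space τ) :=
  inferInstanceAs (Module ℝ (Submodule.span ℝ (A₁ τ)))

/-- The inclusion of `A₁` into `A`. -/
noncomputable def A₁Space.incl : A₁Space τ →ₗ[ℝ] A := (Submodule.span ℝ (A₁ τ)).subtype

/-- The seminorms on the space `A₁` which are at most `x ↦ τ(|x|)`. -/
def minorants : Set (Seminorm ℝ (A₁Space τ)) :=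
  {p | ∀ x : A₁Space τ, A₁Space.incl τ x ∈ A₁ τ →
    p x ≤ (τ (modulus (A₁Space.incl τ x))).toReal}

/-- The norm `‖x‖₁ = τ(|x|)` on `A₁`, written as the largest seminorm which is at most `τ(|x|)`.
For a faithful semi-finite normal trace `x ↦ τ(|x|)` is itself a norm on `A₁`, so the two agree
(see `oneNorm_eq`); in this form the definition makes sense without that fact. -/
noncomputable def oneNorm : Seminorm ℝ (A₁Space τ) := sSup (minorants τ)

/-- Seminorms below `τ(|x|)` are pointwise bounded. -/
theorem bddAbove_minorants : BddAbove (minorants τ) := by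
  rw [Seminorm.bddAbove_iff]
  have key : ∀ x : A, ∀ hx : x ∈ Submodule.span ℝ (A₁ τ),
      ∃ C : ℝ, ∀ p ∈ minorants τ, p (⟨x, hx⟩ : Submodule.span ℝ (A₁ τ)) ≤ C := by
    intro x hx
    induction hx using Submodule.span_induction with
    | mem x h => exact ⟨(τ (modulus x)).toReal, fun p hp => hp ⟨x, Submodule.subset_span h⟩ h⟩
    | zero => exact ⟨0, fun p _ => (map_zero p).le⟩
    | add x y hx hy h₁ h₂ =>
      obtain ⟨C, hC⟩ := h₁
      obtain ⟨D, hD⟩ := h₂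
      exact ⟨C + D, fun p hp =>
        (map_add_le_add p (⟨x, hx⟩ : Submodule.span ℝ (A₁ τ)) ⟨y, hy⟩).trans
          (add_le_add (hC p hp) (hD p hp))⟩
    | smul r x hx h =>
      obtain ⟨C, hC⟩ := h
      refine ⟨‖r‖ * C, fun p hp => ?_⟩
      have := map_smul_eq_mul p r (⟨x, hx⟩ : Submodule.span ℝ (A₁ τ))
      exact this.le.trans (mul_le_mul_of_nonneg_left (hC p hp) (norm_nonneg r))
  choose! C hC using key
  refine ⟨fun x => C x.1, ?_⟩
  rintro _ ⟨p, hp, rfl⟩ x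
  exact hC x.1 x.2 p hp

/-- `oneNorm` is the largest seminorm below `τ(|x|)`. -/
theorem isGreatest_oneNorm : IsGreatest (minorants τ) (oneNorm τ) := by
  have hne : (minorants τ).Nonempty := ⟨0, fun x _ => ENNReal.toReal_nonneg⟩
  refine ⟨fun x hx => ?_, fun p hp => le_csSup (bddAbove_minorants τ) hp⟩
  have : Nonempty (minorants τ) := hne.to_subtype
  rw [oneNorm, Seminorm.sSup_apply (bddAbove_minorants τ)]
  exact ciSup_le fun p => p.2 x hx

/-- If `A₁` is a linear subspace and `x ↦ τ(|x|)` is a seminorm on it (this is always so for a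
faithful semi-finite normal trace), then `oneNorm` is this seminorm. -/
theorem oneNorm_eq (h : ∀ x : A₁Space τ, A₁Space.incl τ x ∈ A₁ τ) (q : Seminorm ℝ (A₁Space τ))
    (hq : ∀ x, q x = (τ (modulus (A₁Space.incl τ x))).toReal) : oneNorm τ = q :=
  le_antisymm (fun x => ((isGreatest_oneNorm τ).1 x (h x)).trans (hq x).ge)
    ((isGreatest_oneNorm τ).2 fun x _ => (hq x).le)

noncomputable instance : SeminormedAddCommGroup (A₁Space τ) :=
  AddGroupSeminorm.toSeminormedAddCommGroup (oneNorm τ).toAddGroupSeminorm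

noncomputable instance : NormedSpace ℝ (A₁Space τ) where
  norm_smul_le r x := (map_smul_eq_mul (oneNorm τ) r x).le

/-- The space `L₁(A, τ)`: the completion of `(A₁, ‖·‖₁)`. -/
def L1 : Type u := UniformSpace.Completion (A₁Space τ)

noncomputable instance : NormedAddCommGroup (L1 τ) :=
  inferInstanceAs (NormedAddCommGroup (UniformSpace.Completion (A₁Space τ)))

noncomputable instance : NormedSpace ℝ (L1 τ) :=
  inferInstanceAs (NormedSpace ℝ (UniformSpace.Completion (A₁Space τ)))

instance : CompleteSpace (L1 τ) :=
  inferInstanceAs (CompleteSpace (UniformSpace.Completion (A₁Space τ)))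

/-- The canonical map of `A₁` into `L₁(A, τ)`. -/
noncomputable def L1.of : A₁Space τ →L[ℝ] L1 τ :=
  (UniformSpace.Completion.toComplL : A₁Space τ →L[ℝ] UniformSpace.Completion (A₁Space τ))

/-- The positive cone of `L₁(A, τ)`: the closure of the positive elements of `A₁`. -/
def L1.posCone : Set (L1 τ) :=
  closure {y | ∃ x : A₁Space τ, A₁Space.incl τ x ∈ A₁ τ ∧
    A₁Space.incl τ x ∈ JBAlgebra.posCone A ∧ L1.of τ x = y}

/-- The order of `L₁(A, τ)`. -/
instance : LE (L1 τ) := ⟨fun x y => y - x ∈ L1.posCone τ⟩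

end L1

variable {A : Type u} [JBAlgebra A] {τ : A → ℝ≥0∞}

/-- A positive contraction of `L₁(A, τ)`. -/
structure IsPositiveContraction (T : L1 τ →L[ℝ] L1 τ) : Prop where
  nonneg : ∀ x : L1 τ, 0 ≤ x → 0 ≤ T x
  norm_le_one : ‖T‖ ≤ 1

/-- `T ≤ S`: the operator `S` dominates `T` on the positive cone. -/
def Dominates (S T : L1 τ →L[ℝ] L1 τ) : Prop :=
  ∀ x : L1 τ, 0 ≤ x → T x ≤ S x

end JBAlgebra

/-!
The norm of `L₁(A, τ)` is additive on the positive cone, and the norm of an operator is determined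
there. For positive `x`, the operator `Sⁿ - Tⁿ` being positive, `‖(Sⁿ - Tⁿ) x‖ = ‖Sⁿ x‖ - ‖Tⁿ x‖`,
and a convex combination of two estimates of
`(Sⁿ⁺¹ - Tⁿ⁺¹) x = S ((Sⁿ - Tⁿ) x) + (S - T) (Tⁿ x)` yields
`‖Sⁿ⁺¹ - Tⁿ⁺¹‖ ≤ ‖S - T‖ + (1 - ‖S - T‖) ‖Sⁿ - Tⁿ‖` up to a harmless maximum with a positive
constant (`norm_pow_succ_sub_pow_succ_le`). Induction on `n` concludes.

The two facts on `L₁(A, τ)` are `exists_functional_eq_norm` and `opNorm_le_of_posCone`. Both follow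
from the maximality of `‖·‖₁` among the seminorms below `τ(|x|)`, given the decomposition
`x = x⁺ - x⁻`, `|x| = x⁺ + x⁻` with `x⁺, x⁻ ∈ A⁺` (`exists_posPart_negPart`), the equality `|a| = a`
for positive `a` (`modulus_eq_self`) and the convexity of the cone of squares (`add_mem_posCone`).

These order properties need no spectral theorem. An element `x` of a Jordan algebra generates an
associative closed subalgebra `C(x)` (`mul_assoc_of_mem_closedSubalgebra`), in which square roots
of `1 - w`, `‖w‖ ≤ 1`, are given by a convergent power series with Catalan coefficients
(`exists_sqrt_one_sub`). Hence the squares are exactly the elements `a` with `‖r 1 - a‖ ≤ r` for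
some `r ≥ 0` (`mem_posCone_iff`), a condition which is visibly convex; uniqueness of positive square
roots (`IsAssocJB.sqrt_unique`) and the rest are then algebra in `C(x)`.
-/

namespace JBAlgebra

/-! ### Square roots in associative JB-algebras -/

/-- The partial sums of `∑ Cₙ / 4ⁿ` (`Cₙ` the Catalan numbers) are bounded by `2`, the fixed point
of `s ↦ 1 + s² / 4`. -/
theorem sum_catalan_div_le (N : ℕ) :
    ∑ n ∈ Finset.range N, (catalan n : ℝ) / 4 ^ n ≤ 2 := by
  induction N with
  | zero => simp
  | succ N ih =>
    set f : ℕ → ℝ := fun n => (catalan n : ℝ) / 4 ^ n with hf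
    have hf0 : ∀ n, 0 ≤ f n := fun n => by positivity
    have hrec : ∀ n, f (n + 1) = (1 / 4) * ∑ k ∈ Finset.range (n + 1), f k * f (n - k) := by
      intro n
      simp only [hf]
      rw [catalan_succ', Finset.Nat.sum_antidiagonal_eq_sum_range_succ
        (fun i j => catalan i * catalan j)]
      push_cast
      rw [Finset.sum_div, Finset.mul_sum]
      refine Finset.sum_congr rfl fun k hk => ?_
      have hkn : k ≤ n := Nat.lt_succ_iff.1 (Finset.mem_range.1 hk)
      have : (4 : ℝ) ^ (n + 1) = 4 * (4 ^ k * 4 ^ (n - k)) := by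
        rw [← pow_add, Nat.add_sub_cancel' hkn]; ring
      rw [this]
      field_simp
    rw [Finset.sum_range_succ']
    have h1 : ∑ n ∈ Finset.range N, f (n + 1)
        ≤ (1 / 4) * ((∑ n ∈ Finset.range N, f n) * ∑ n ∈ Finset.range N, f n) := by
      simp_rw [hrec]
      rw [← Finset.mul_sum, Finset.sum_range_diag_flip N (fun i j => f i * f j),
        Finset.sum_mul]
      gcongr with m hm
      rw [Finset.mul_sum]
      exact Finset.sum_le_sum_of_subset_of_nonneg (Finset.range_mono (Nat.sub_le _ _))
        fun i _ _ => mul_nonneg (hf0 m) (hf0 i)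
    have h0 : 0 ≤ ∑ n ∈ Finset.range N, f n := Finset.sum_nonneg fun n _ => hf0 n
    have h2 : f 0 = 1 := by simp [hf]
    change ∑ n ∈ Finset.range N, f (n + 1) + f 0 ≤ 2
    nlinarith

section Assoc

variable {B : Type*} [NormedCommRing B] [NormedAlgebra ℝ B]

/-- `1 - w` has a square root within distance `1` of `1` as soon as `‖w‖ ≤ 1`. With
`G = ∑ Cₙ (w / 4)ⁿ` (`Cₙ` the Catalan numbers) the Catalan recursion reads `G = 1 + w G² / 4`, so
`1 - w G / 2` is such a root. -/
theorem exists_sqrt_one_sub [CompleteSpace B] (h1 : ‖(1 : B)‖ ≤ 1) {w : B} (hw : ‖w‖ ≤ 1) :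
    ∃ s : B, s * s = 1 - w ∧ ‖1 - s‖ ≤ 1 := by
  set f : ℕ → ℝ := fun n => (catalan n : ℝ) / 4 ^ n with hf
  have hf0 : ∀ n, 0 ≤ f n := fun n => by positivity
  have hfs : Summable f := summable_of_sum_range_le hf0 sum_catalan_div_le
  have hwn : ∀ n, ‖w ^ n‖ ≤ 1 := by
    intro n
    induction n with
    | zero => simpa using h1
    | succ n ih =>
      rw [pow_succ]
      exact (_root_.norm_mul_le _ _).trans (mul_le_one₀ ih (norm_nonneg _) hw)
  set g : ℕ → B := fun n => f n • w ^ n with hg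
  have hgf : ∀ n, ‖g n‖ ≤ f n := fun n => by
    rw [hg, norm_smul, Real.norm_of_nonneg (hf0 n)]
    exact mul_le_of_le_one_right (hf0 n) (hwn n)
  have hgs : Summable fun n => ‖g n‖ := Summable.of_nonneg_of_le (fun _ => norm_nonneg _) hgf hfs
  set G : B := ∑' n, g n with hG
  have hGn : ‖G‖ ≤ 2 := (tsum_of_norm_bounded hfs.hasSum hgf).trans
    (hfs.tsum_le_of_sum_range_le sum_catalan_div_le)
  have hGG : (1 / 4 : ℝ) • (w * (G * G)) = ∑' n, g (n + 1) := by
    rw [hG, tsum_mul_tsum_eq_tsum_sum_antidiagonal_of_summable_norm hgs hgs,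
      ← Summable.tsum_mul_left, ← Summable.tsum_const_smul]
    · refine tsum_congr fun n => ?_
      have h3 : ∑ kl ∈ Finset.HasAntidiagonal.antidiagonal n, g kl.1 * g kl.2 = (4 * f (n + 1)) • w ^ n := by
        have : 4 * f (n + 1) = ∑ kl ∈ Finset.HasAntidiagonal.antidiagonal n, f kl.1 * f kl.2 := by
          simp only [hf]
          rw [catalan_succ']
          push_cast
          rw [Finset.sum_div, Finset.mul_sum]
          refine Finset.sum_congr rfl fun k hk => ?_
          rw [← Finset.HasAntidiagonal.mem_antidiagonal.1 hk, pow_succ, pow_add]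
          field_simp
        rw [this, Finset.sum_smul]
        refine Finset.sum_congr rfl fun k hk => ?_
        rw [hg, ← Finset.HasAntidiagonal.mem_antidiagonal.1 hk, pow_add, smul_mul_smul_comm]
      rw [h3, hg, mul_smul_comm, smul_smul, ← pow_succ']
      congr 1
      ring
    · exact (summable_norm_sum_mul_antidiagonal_of_summable_norm hgs hgs).of_norm.mul_left _
    · exact (summable_norm_sum_mul_antidiagonal_of_summable_norm hgs hgs).of_norm
  have hGeq : G = 1 + (1 / 4 : ℝ) • (w * (G * G)) := by
    rw [hGG, hG, hgs.of_norm.tsum_eq_zero_add]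
    simp [hg, hf]
  refine ⟨1 - (1 / 2 : ℝ) • (w * G), ?_, ?_⟩
  · have h4 : (1 / 2 : ℝ) • (w * G) * ((1 / 2 : ℝ) • (w * G))
        = w * ((1 / 4 : ℝ) • (w * (G * G))) := by
      rw [smul_mul_smul_comm, mul_smul_comm]
      congr 1
      · norm_num
      · ring
    have h5 : (1 / 4 : ℝ) • (w * (G * G)) = G - 1 := by rw [eq_sub_iff_add_eq', ← hGeq]
    have h6 : (1 / 2 : ℝ) • (w * G) + (1 / 2 : ℝ) • (w * G) = w * G := by
      rw [← add_smul]; norm_num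
    rw [h5] at h4
    linear_combination h4 - h6
  · rw [sub_sub_cancel, norm_smul, Real.norm_of_nonneg (by norm_num)]
    have := (_root_.norm_mul_le w G).trans (mul_le_mul hw hGn (norm_nonneg _) zero_le_one)
    linarith

end Assoc

/-- The order-unit description of positivity: `a` is norm-positive if `‖r 1 - a‖ ≤ r` for some
`r ≥ 0`. In this form it is evident that the positive elements form a convex cone; in a JB-algebra
they are exactly the squares. -/
def NormPos {B : Type*} [NormedAddCommGroup B] [NormedSpace ℝ B] [One B] (a : B) : Prop :=
  ∃ r : ℝ, 0 ≤ r ∧ ‖r • (1 : B) - a‖ ≤ r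

theorem NormPos.add {B : Type*} [NormedAddCommGroup B] [NormedSpace ℝ B] [One B] {a b : B}
    (ha : NormPos a) (hb : NormPos b) : NormPos (a + b) := by
  obtain ⟨r, hr, h⟩ := ha
  obtain ⟨s, hs, h'⟩ := hb
  refine ⟨r + s, by positivity, ?_⟩
  have : (r + s) • (1 : B) - (a + b) = (r • (1 : B) - a) + (s • (1 : B) - b) := by
    rw [add_smul]; abel
  rw [this]
  exact (norm_add_le _ _).trans (add_le_add h h')

/-- The norm axioms of a JB-algebra, for an associative commutative Banach algebra. -/
structure IsAssocJB (B : Type*) [NormedCommRing B] : Prop where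
  norm_sq : ∀ a : B, ‖a * a‖ = ‖a‖ ^ 2
  norm_sq_le : ∀ a b : B, ‖a * a‖ ≤ ‖a * a + b * b‖

namespace IsAssocJB

variable {B : Type*} [NormedCommRing B] (hB : IsAssocJB B)
include hB

theorem norm_one_le : ‖(1 : B)‖ ≤ 1 := by
  have := hB.norm_sq 1
  rw [mul_one] at this
  nlinarith [norm_nonneg (1 : B)]

theorem eq_zero_of_mul_self {a : B} (h : a * a = 0) : a = 0 := by
  have := hB.norm_sq a
  rw [h, norm_zero] at this
  exact norm_eq_zero.1 (pow_eq_zero_iff two_ne_zero |>.1 this.symm)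

variable [NormedAlgebra ℝ B] [CompleteSpace B]

theorem exists_sqrt {a : B} (ha : NormPos a) : ∃ s : B, NormPos s ∧ s * s = a := by
  obtain ⟨r, hr, h⟩ := ha
  rcases hr.eq_or_lt with rfl | hr
  · have : a = 0 := by simpa using h
    exact ⟨0, ⟨0, le_rfl, by simp⟩, by simp [this]⟩
  obtain ⟨s, hs, hs1⟩ := exists_sqrt_one_sub (B := B) hB.norm_one_le (w := 1 - r⁻¹ • a) (by
    have : (1 : B) - r⁻¹ • a = r⁻¹ • (r • (1 : B) - a) := by
      rw [smul_sub, smul_smul, inv_mul_cancel₀ hr.ne', one_smul]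
    rw [this, norm_smul, Real.norm_of_nonneg (by positivity)]
    calc r⁻¹ * _ ≤ r⁻¹ * r := by gcongr
      _ = 1 := inv_mul_cancel₀ hr.ne')
  refine ⟨√r • s, ⟨√r, by positivity, ?_⟩, ?_⟩
  · rw [← smul_sub, norm_smul, Real.norm_of_nonneg (by positivity)]
    exact mul_le_of_le_one_right (by positivity) hs1
  · rw [smul_mul_smul_comm, hs, Real.mul_self_sqrt hr.le, sub_sub_cancel, smul_smul,
      mul_inv_cancel₀ hr.ne', one_smul]

theorem normPos_mul_self (z : B) : NormPos (z * z) := by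
  rcases eq_or_ne z 0 with rfl | hz
  · exact ⟨0, le_rfl, by simp⟩
  have hr : 0 < ‖z‖ := norm_pos_iff.2 hz
  obtain ⟨s, hs, -⟩ := exists_sqrt_one_sub (B := B) hB.norm_one_le
      (w := (‖z‖⁻¹ • z) * (‖z‖⁻¹ • z)) (by
    rw [hB.norm_sq, norm_smul, norm_inv, norm_norm, inv_mul_cancel₀ hr.ne', one_pow])
  have key : (‖z‖ • s) * (‖z‖ • s) = ‖z‖ ^ 2 • (1 : B) - z * z := by
    rw [smul_mul_smul_comm, hs, smul_sub, smul_mul_smul_comm, smul_smul]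
    congr 1
    · rw [sq]
    · rw [show ‖z‖ * ‖z‖ * (‖z‖⁻¹ * ‖z‖⁻¹) = 1 by field_simp, one_smul]
  refine ⟨‖z‖ ^ 2, by positivity, ?_⟩
  rw [← key]
  refine (hB.norm_sq_le _ z).trans ?_
  rw [key, sub_add_cancel, norm_smul, Real.norm_of_nonneg (by positivity)]
  exact mul_le_of_le_one_right (by positivity) hB.norm_one_le

theorem normPos_mul {a b : B} (ha : NormPos a) (hb : NormPos b) : NormPos (a * b) := by
  obtain ⟨s, -, rfl⟩ := hB.exists_sqrt ha
  obtain ⟨t, -, rfl⟩ := hB.exists_sqrt hb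
  rw [mul_mul_mul_comm]
  exact hB.normPos_mul_self _

theorem eq_zero_of_add_eq_zero {a b : B} (ha : NormPos a) (hb : NormPos b) (h : a + b = 0) :
    a = 0 := by
  obtain ⟨s, -, rfl⟩ := hB.exists_sqrt ha
  obtain ⟨t, -, rfl⟩ := hB.exists_sqrt hb
  have := hB.norm_sq_le s t
  rw [h, norm_zero] at this
  exact norm_le_zero_iff.1 this

theorem sqrt_unique {u v : B} (hu : NormPos u) (hv : NormPos v) (h : u * u = v * v) : u = v := by
  have h1 := hB.normPos_mul (hB.normPos_mul_self (u - v)) hu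
  have h2 := hB.normPos_mul (hB.normPos_mul_self (u - v)) hv
  have h3 := hB.eq_zero_of_add_eq_zero h1 h2 (by linear_combination (u - v) * h)
  have h4 := hB.eq_zero_of_add_eq_zero h2 h1 (by linear_combination (u - v) * h)
  have h5 : ((u - v) * (u - v)) * ((u - v) * (u - v)) = 0 := by
    linear_combination (u - v) * h3 - (u - v) * h4
  exact sub_eq_zero.1 (hB.eq_zero_of_mul_self (hB.eq_zero_of_mul_self h5))

/-- The positive square root `y` of `x²` dominates `-x`. The elements `p = y + x` and `q = y - x`
have product `0` and positive sum, so uniqueness of square roots gives `|p| + |q| = p + q`, and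
multiplication by `|p|` gives `|p| = p`. -/
theorem normPos_add_of_mul_self_eq {x y : B} (hy : NormPos y) (h : y * y = x * x) :
    NormPos (y + x) := by
  obtain ⟨p, hp, hpp⟩ := hB.exists_sqrt (hB.normPos_mul_self (y + x))
  obtain ⟨q, hq, hqq⟩ := hB.exists_sqrt (hB.normPos_mul_self (y - x))
  have hxy : (y + x) * (y - x) = 0 := by linear_combination h
  have hpq : p * q = 0 := hB.eq_zero_of_mul_self (by
    linear_combination q * q * hpp + (y + x) * (y + x) * hqq + (y + x) * (y - x) * hxy)
  have hpx : p * (y - x) = 0 := hB.eq_zero_of_mul_self (by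
    linear_combination (y - x) * (y - x) * hpp + (y + x) * (y - x) * hxy)
  have hsum : p + q = y + y := hB.sqrt_unique (hp.add hq) (hy.add hy) (by
    linear_combination 2 * hpq + hpp + hqq - 2 * h)
  have h2 : p * p = p * (y + x) := by linear_combination p * hsum - hpq + hpx
  have h3 : p - (y + x) = 0 := hB.eq_zero_of_mul_self (by linear_combination 2 * h2 - hpp)
  rwa [← sub_eq_zero.1 h3]

end IsAssocJB

/-! ### Power associativity -/

section PowerAssociative

variable {A : Type u} [JBAlgebra A]

instance : IsScalarTower ℝ A A := ⟨fun r a b => JBAlgebra.smul_mul r a b⟩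

instance : SMulCommClass ℝ A A := ⟨fun r a b => by
  change r • (a * b) = a * (r • b)
  rw [mul_comm a b, mul_comm a, JBAlgebra.smul_mul]⟩

instance : IsCommJordan A := ⟨fun a b => by
  have := JBAlgebra.jordan a b
  rw [mul_comm a b, mul_comm (b * a), this, mul_comm _ a, mul_comm (a * a) b]⟩

instance : ContinuousMul A where
  continuous_mul := ((LinearMap.mul ℝ A).mkContinuous₂ 1 fun a b => by
    simpa using JBAlgebra.norm_mul_le a b).continuous₂

/-- The fully linearized Jordan identity. -/
theorem jordan_linearized (a b c d : A) :
    a * (b * c * d) + b * (c * a * d) + c * (a * b * d)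
      = b * c * (a * d) + c * a * (b * d) + a * b * (c * d) := by
  have h := congrArg (fun f : AddMonoid.End A => f d) (two_nsmul_lie_lmul_lmul_add_add_eq_zero a b c)
  simp only [Ring.lie_def] at h
  change (2 : ℕ) • ((a * (b * c * d) - b * c * (a * d)) + (b * (c * a * d) - c * a * (b * d))
    + (c * (a * b * d) - a * b * (c * d))) = 0 at h
  rw [← Nat.cast_smul_eq_nsmul ℝ] at h
  have h' := (smul_eq_zero.1 h).resolve_left (by norm_num)
  rw [← sub_eq_zero, ← h']
  abel

/-- The right-hand side of `jordan_linearized` is symmetric in all four variables; this expresses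
multiplication by a triple product through multiplications by products of two factors. -/
theorem triple_mul (a b c d : A) :
    b * c * a * d = a * (b * c * d) + b * (c * a * d) + c * (a * b * d)
      - b * (a * (c * d)) - c * (a * (b * d)) := by
  have h1 := jordan_linearized a b c d
  have h2 := jordan_linearized d b c a
  have e1 : b * c * (d * a) = b * c * (a * d) := by rw [mul_comm d a]
  have e2 : c * d * (b * a) = a * b * (c * d) := by rw [mul_comm b a, mul_comm]
  have e3 : d * b * (c * a) = c * a * (b * d) := by rw [mul_comm d b, mul_comm]
  have e4 : d * (b * c * a) = b * c * a * d := mul_comm _ _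
  have e5 : b * (c * d * a) = b * (a * (c * d)) := by rw [mul_comm (c * d)]
  have e6 : c * (d * b * a) = c * (a * (b * d)) := by rw [mul_comm d b, mul_comm (b * d)]
  rw [e1, e2, e3, e4, e5, e6] at h2
  have h3 : b * c * a * d + b * (a * (c * d)) + c * (a * (b * d))
      = a * (b * c * d) + b * (c * a * d) + c * (a * b * d) := by
    rw [h1, h2]; abel
  rw [← h3]; abel

/-- The powers of an element of a Jordan algebra. -/
def jpow (x : A) : ℕ → A
  | 0 => 1
  | n + 1 => x * jpow x n

/-- Multiplication by `xⁿ` commutes with the multiplications by `x` and `x²`: by `triple_mul` it is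
a polynomial in these two. -/
theorem jpow_mul_comm (x : A) (n : ℕ) :
    (∀ z : A, jpow x n * (x * z) = x * (jpow x n * z)) ∧
      ∀ z : A, jpow x n * (x * x * z) = x * x * (jpow x n * z) := by
  have hx : ∀ z : A, x * (x * x * z) = x * x * (x * z) := fun z => by
    rw [mul_comm x z, JBAlgebra.jordan, mul_comm]
  induction n using Nat.strong_induction_on with
  | _ n ih =>
    match n, ih with
    | 0, _ => simp [jpow]
    | 1, _ => simpa [jpow] using hx
    | n + 2, ih =>
      obtain ⟨h0, k0⟩ := ih n (by omega)
      obtain ⟨h1, k1⟩ := ih (n + 1) (by omega)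
      have hrec : ∀ z : A, jpow x (n + 2) * z = x * (jpow x (n + 1) * z)
          + x * (jpow x (n + 1) * z) + jpow x n * (x * x * z)
          - x * (x * (jpow x n * z)) - jpow x n * (x * (x * z)) := by
        intro z
        have h := triple_mul x x (jpow x n) z
        have e : jpow x n * x = jpow x (n + 1) := mul_comm _ _
        have e' : x * jpow x n = jpow x (n + 1) := rfl
        have e'' : jpow x (n + 1) * x = jpow x (n + 2) := mul_comm _ _
        rwa [e', e, e''] at h
      constructor <;> intro z
      · rw [hrec, hrec]
        simp only [mul_add, mul_sub, h0, h1, k0, hx]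
      · rw [hrec, hrec]
        simp only [mul_add, mul_sub, h0, k0, k1, hx]

theorem jpow_mul_jpow (x : A) (m n : ℕ) : jpow x m * jpow x n = jpow x (m + n) := by
  induction n with
  | zero => exact mul_one _
  | succ n ih =>
    change jpow x m * (x * jpow x n) = x * jpow x (m + n)
    rw [(jpow_mul_comm x m).1, ih]

/-- The norm-closed subalgebra `C(x)` generated by `1` and `x`. -/
def closedSubalgebra (x : A) : Submodule ℝ A :=
  (Submodule.span ℝ (Set.range (jpow x))).topologicalClosure

theorem isClosed_closedSubalgebra (x : A) : IsClosed (closedSubalgebra x : Set A) :=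
  Submodule.isClosed_topologicalClosure _

theorem jpow_mem_closedSubalgebra (x : A) (n : ℕ) : jpow x n ∈ closedSubalgebra x :=
  Submodule.le_topologicalClosure _ (Submodule.subset_span ⟨n, rfl⟩)

theorem one_mem_closedSubalgebra (x : A) : (1 : A) ∈ closedSubalgebra x :=
  jpow_mem_closedSubalgebra x 0

theorem self_mem_closedSubalgebra (x : A) : x ∈ closedSubalgebra x := by
  simpa [jpow] using jpow_mem_closedSubalgebra x 1

/-- Closed linear conditions on `C(x)` need only be tested on the powers of `x`. -/
theorem closedSubalgebra_induction {x : A} (V : Submodule ℝ A) (hV : IsClosed (V : Set A))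
    (h : ∀ n, jpow x n ∈ V) {a : A} (ha : a ∈ closedSubalgebra x) : a ∈ V :=
  Submodule.topologicalClosure_minimal _
    (Submodule.span_le.2 (Set.range_subset_iff.2 h)) hV ha

theorem mul_mem_closedSubalgebra {x a b : A} (ha : a ∈ closedSubalgebra x)
    (hb : b ∈ closedSubalgebra x) : a * b ∈ closedSubalgebra x := by
  have hcl := isClosed_closedSubalgebra x
  refine closedSubalgebra_induction ((closedSubalgebra x).comap (LinearMap.mulRight ℝ b))
    (hcl.preimage (continuous_mul_const b)) (fun m => ?_) ha
  refine closedSubalgebra_induction ((closedSubalgebra x).comap (LinearMap.mulLeft ℝ (jpow x m)))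
    (hcl.preimage (continuous_const_mul (jpow x m))) (fun n => ?_) hb
  change jpow x m * jpow x n ∈ closedSubalgebra x
  rw [jpow_mul_jpow]
  exact jpow_mem_closedSubalgebra x _

theorem mul_assoc_of_mem_closedSubalgebra {x a b c : A} (ha : a ∈ closedSubalgebra x)
    (hb : b ∈ closedSubalgebra x) (hc : c ∈ closedSubalgebra x) : a * b * c = a * (b * c) := by
  refine closedSubalgebra_induction (LinearMap.eqLocus
    (LinearMap.mulRight ℝ c ∘ₗ LinearMap.mulRight ℝ b) (LinearMap.mulRight ℝ (b * c)))
    (isClosed_eq (f := fun y : A => y * b * c) (g := fun y : A => y * (b * c))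
      (by fun_prop) (by fun_prop)) (fun m => ?_) ha
  refine closedSubalgebra_induction (LinearMap.eqLocus
    (LinearMap.mulRight ℝ c ∘ₗ LinearMap.mulLeft ℝ (jpow x m))
    (LinearMap.mulLeft ℝ (jpow x m) ∘ₗ LinearMap.mulRight ℝ c))
    (isClosed_eq (f := fun y : A => jpow x m * y * c) (g := fun y : A => jpow x m * (y * c))
      (by fun_prop) (by fun_prop)) (fun n => ?_) hb
  refine closedSubalgebra_induction (LinearMap.eqLocus
    (LinearMap.mulLeft ℝ (jpow x m * jpow x n))
    (LinearMap.mulLeft ℝ (jpow x m) ∘ₗ LinearMap.mulLeft ℝ (jpow x n)))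
    (isClosed_eq (f := fun y : A => jpow x m * jpow x n * y)
      (g := fun y : A => jpow x m * (jpow x n * y))
      (by fun_prop) (by fun_prop)) (fun k => ?_) hc
  change jpow x m * jpow x n * jpow x k = jpow x m * (jpow x n * jpow x k)
  simp only [jpow_mul_jpow, add_assoc]

theorem closedSubalgebra_le {x y : A} (h : y ∈ closedSubalgebra x) :
    closedSubalgebra y ≤ closedSubalgebra x := by
  refine fun a => closedSubalgebra_induction _ (isClosed_closedSubalgebra x) fun n => ?_
  induction n with
  | zero => exact one_mem_closedSubalgebra x
  | succ n ih => exact mul_mem_closedSubalgebra h ih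

instance (x : A) : NormedCommRing (closedSubalgebra x) where
  __ := (inferInstance : NormedAddCommGroup (closedSubalgebra x))
  mul a b := ⟨a * b, mul_mem_closedSubalgebra a.2 b.2⟩
  one := ⟨1, one_mem_closedSubalgebra x⟩
  left_distrib a b c := Subtype.ext (mul_add (a : A) b c)
  right_distrib a b c := Subtype.ext (add_mul (a : A) b c)
  zero_mul a := Subtype.ext (zero_mul (a : A))
  mul_zero a := Subtype.ext (mul_zero (a : A))
  mul_assoc a b c := Subtype.ext (mul_assoc_of_mem_closedSubalgebra a.2 b.2 c.2)
  one_mul a := Subtype.ext (one_mul (a : A))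
  mul_one a := Subtype.ext (mul_one (a : A))
  mul_comm a b := Subtype.ext (mul_comm (a : A) b)
  norm_mul_le a b := JBAlgebra.norm_mul_le (a : A) b

instance (x : A) : NormedAlgebra ℝ (closedSubalgebra x) where
  __ := Algebra.ofModule (R := ℝ) (A := closedSubalgebra x)
    (fun r a b => Subtype.ext (smul_mul_assoc r (a : A) b))
    (fun r a b => Subtype.ext (mul_smul_comm r (a : A) b))
  norm_smul_le r a := norm_smul_le r (a : A)

instance (x : A) : CompleteSpace (closedSubalgebra x) :=
  (isClosed_closedSubalgebra x).completeSpace_coe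

theorem isAssocJB_closedSubalgebra (x : A) : IsAssocJB (closedSubalgebra x) where
  norm_sq a := JBAlgebra.norm_sq (a : A)
  norm_sq_le a b := JBAlgebra.norm_sq_le (a : A) b

end PowerAssociative

/-! ### The positive cone and the modulus -/

section Modulus

variable {A : Type u} [JBAlgebra A]

theorem normPos_coe_iff {x : A} {a : closedSubalgebra x} : NormPos (a : A) ↔ NormPos a :=
  Iff.rfl

theorem mem_posCone_iff {a : A} : a ∈ posCone A ↔ NormPos a := by
  constructor
  · rintro ⟨c, rfl⟩
    exact normPos_coe_iff.2 ((isAssocJB_closedSubalgebra c).normPos_mul_self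
      ⟨c, self_mem_closedSubalgebra c⟩)
  · intro h
    obtain ⟨s, -, hs⟩ := (isAssocJB_closedSubalgebra a).exists_sqrt
      (a := ⟨a, self_mem_closedSubalgebra a⟩) h
    exact ⟨s, (congrArg Subtype.val hs).symm⟩

theorem add_mem_posCone {a b : A} (ha : a ∈ posCone A) (hb : b ∈ posCone A) :
    a + b ∈ posCone A :=
  mem_posCone_iff.2 ((mem_posCone_iff.1 ha).add (mem_posCone_iff.1 hb))

theorem zero_mem_posCone : (0 : A) ∈ posCone A := ⟨0, by simp⟩

theorem smul_mem_posCone {r : ℝ} (hr : 0 ≤ r) {a : A} (ha : a ∈ posCone A) :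
    r • a ∈ posCone A := by
  obtain ⟨c, rfl⟩ := ha
  exact ⟨√r • c, by rw [smul_mul_smul_comm, Real.mul_self_sqrt hr]⟩

/-- A positive square root of `x²` lies in `C(x)`: it agrees with the root found in `C(x²)`, by
uniqueness in the subalgebra it generates itself. -/
theorem mem_closedSubalgebra_of_mul_self_eq {x y : A} (hy : y ∈ posCone A)
    (h : y * y = x * x) : y ∈ closedSubalgebra x := by
  have hx : x * x ∈ closedSubalgebra x :=
    mul_mem_closedSubalgebra (self_mem_closedSubalgebra x) (self_mem_closedSubalgebra x)
  have hxy : x * x ∈ closedSubalgebra y :=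
    h ▸ mul_mem_closedSubalgebra (self_mem_closedSubalgebra y) (self_mem_closedSubalgebra y)
  obtain ⟨z, hz, hzz⟩ := (isAssocJB_closedSubalgebra (x * x)).exists_sqrt
    (a := ⟨x * x, self_mem_closedSubalgebra (x * x)⟩) (mem_posCone_iff.1 ⟨x, rfl⟩)
  have hzz' : (z : A) * z = x * x := congrArg Subtype.val hzz
  have key := (isAssocJB_closedSubalgebra y).sqrt_unique
    (u := ⟨y, self_mem_closedSubalgebra y⟩) (v := ⟨z, closedSubalgebra_le hxy z.2⟩)
    (mem_posCone_iff.1 hy) hz (Subtype.ext (h.trans hzz'.symm))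
  have : y = z := congrArg Subtype.val key
  exact this ▸ closedSubalgebra_le hx z.2

theorem modulus_mul_self (x : A) : modulus x * modulus x = x * x := by
  obtain ⟨s, hs, hss⟩ := (isAssocJB_closedSubalgebra x).exists_sqrt
    ((isAssocJB_closedSubalgebra x).normPos_mul_self ⟨x, self_mem_closedSubalgebra x⟩)
  have h : ∃ y ∈ posCone A, y * y = x * x :=
    ⟨s, mem_posCone_iff.2 hs, congrArg Subtype.val hss⟩
  rw [modulus, dif_pos h]
  exact h.choose_spec.2

theorem add_mem_posCone_of_mul_self_eq {x y : A} (hy : y ∈ posCone A) (h : y * y = x * x) :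
    y + x ∈ posCone A :=
  mem_posCone_iff.2 ((isAssocJB_closedSubalgebra x).normPos_add_of_mul_self_eq
    (x := ⟨x, self_mem_closedSubalgebra x⟩)
    (y := ⟨y, mem_closedSubalgebra_of_mul_self_eq hy h⟩)
    (mem_posCone_iff.1 hy) (Subtype.ext h))

theorem modulus_eq_self {a : A} (ha : a ∈ posCone A) : modulus a = a :=
  congrArg Subtype.val ((isAssocJB_closedSubalgebra a).sqrt_unique
    (u := ⟨modulus a, mem_closedSubalgebra_of_mul_self_eq (modulus_mem_posCone a)
      (modulus_mul_self a)⟩) (v := ⟨a, self_mem_closedSubalgebra a⟩)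
    (mem_posCone_iff.1 (modulus_mem_posCone a)) (mem_posCone_iff.1 ha)
    (Subtype.ext (modulus_mul_self a)))

/-- The decomposition `x = x⁺ - x⁻`, with `x⁺ + x⁻ = |x|`. -/
theorem exists_posPart_negPart (x : A) :
    ∃ a ∈ posCone A, ∃ b ∈ posCone A, x = a - b ∧ modulus x = a + b := by
  have h1 := add_mem_posCone_of_mul_self_eq (modulus_mem_posCone x) (modulus_mul_self x)
  have h2 := add_mem_posCone_of_mul_self_eq (x := -x) (modulus_mem_posCone x)
    (by rw [modulus_mul_self, neg_mul_neg])
  refine ⟨(1 / 2 : ℝ) • (modulus x + x), smul_mem_posCone (by norm_num) h1,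
    (1 / 2 : ℝ) • (modulus x + -x), smul_mem_posCone (by norm_num) h2, ?_, ?_⟩ <;>
  module

end Modulus

/-! ### The trace as the norm of the positive cone -/

section Trace

variable {A : Type u} [JBAlgebra A] {τ : A → ℝ≥0∞}

variable (τ) in
/-- The cone of the positive elements of finite trace. -/
def finiteCone : Set A := {a | a ∈ posCone A ∧ τ a < ∞}

theorem mem_A₁_iff_of_mem_posCone {a : A} (ha : a ∈ posCone A) : a ∈ A₁ τ ↔ τ a < ∞ := by
  change τ (modulus a) < ∞ ↔ _
  rw [modulus_eq_self ha]

namespace IsTrace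

variable (hτ : IsTrace τ)
include hτ

theorem map_add {a b : A} (ha : a ∈ posCone A) (hb : b ∈ posCone A) : τ (a + b) = τ a + τ b := by
  simpa using hτ.add_smul a ha b hb 1

theorem add_mem_finiteCone {a b : A} (ha : a ∈ finiteCone τ) (hb : b ∈ finiteCone τ) :
    a + b ∈ finiteCone τ :=
  ⟨add_mem_posCone ha.1 hb.1, by
    rw [hτ.map_add ha.1 hb.1]; exact ENNReal.add_lt_top.2 ⟨ha.2, hb.2⟩⟩

theorem toReal_map_add {a b : A} (ha : a ∈ finiteCone τ) (hb : b ∈ finiteCone τ) :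
    (τ (a + b)).toReal = (τ a).toReal + (τ b).toReal := by
  rw [hτ.map_add ha.1 hb.1, ENNReal.toReal_add ha.2.ne hb.2.ne]

/-- Semi-finiteness excludes the trace which is constantly `∞`. -/
theorem map_zero (hs : IsSemifinite τ) : τ 0 = 0 := by
  obtain ⟨D, hD, ⟨d, hd⟩, -, -, hfin⟩ := hs
  have h := hτ.map_add (hD hd) (zero_mem_posCone (A := A))
  rw [add_zero] at h
  exact (ENNReal.add_right_inj (hfin d hd).ne).1 (by rw [← h, add_zero])

theorem zero_mem_finiteCone (hs : IsSemifinite τ) : (0 : A) ∈ finiteCone τ :=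
  ⟨zero_mem_posCone, by simp [hτ.map_zero hs]⟩

theorem map_smul (hs : IsSemifinite τ) {a : A} (ha : a ∈ posCone A) (r : ℝ≥0) :
    τ ((r : ℝ) • a) = r * τ a := by
  have := hτ.add_smul 0 zero_mem_posCone a ha r
  rwa [zero_add, hτ.map_zero hs, zero_add] at this

theorem smul_mem_finiteCone (hs : IsSemifinite τ) {a : A} (ha : a ∈ finiteCone τ) {r : ℝ}
    (hr : 0 ≤ r) : r • a ∈ finiteCone τ := by
  lift r to ℝ≥0 using hr
  exact ⟨smul_mem_posCone r.2 ha.1, by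
    rw [hτ.map_smul hs ha.1]; exact ENNReal.mul_lt_top ENNReal.coe_lt_top ha.2⟩

theorem toReal_map_smul (hs : IsSemifinite τ) {a : A} (ha : a ∈ finiteCone τ) {r : ℝ}
    (hr : 0 ≤ r) : (τ (r • a)).toReal = r * (τ a).toReal := by
  lift r to ℝ≥0 using hr
  rw [hτ.map_smul hs ha.1, ENNReal.toReal_mul, ENNReal.coe_toReal]

theorem exists_decomp_of_mem_A₁ {x : A} (hx : x ∈ A₁ τ) :
    ∃ a ∈ finiteCone τ, ∃ b ∈ finiteCone τ, x = a - b ∧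
      (τ (modulus x)).toReal = (τ a).toReal + (τ b).toReal := by
  obtain ⟨a, ha, b, hb, h, hm⟩ := exists_posPart_negPart x
  have hx' : τ (modulus x) < ∞ := hx
  rw [hm, hτ.map_add ha hb, ENNReal.add_lt_top] at hx'
  refine ⟨a, ⟨ha, hx'.1⟩, b, ⟨hb, hx'.2⟩, h, ?_⟩
  rw [hm, hτ.toReal_map_add ⟨ha, hx'.1⟩ ⟨hb, hx'.2⟩]

theorem exists_decomp (hs : IsSemifinite τ) (x : A₁Space τ) :
    ∃ p : A × A, p.1 ∈ finiteCone τ ∧ p.2 ∈ finiteCone τ ∧ A₁Space.incl τ x = p.1 - p.2 := by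
  obtain ⟨x, hx⟩ := x
  change ∃ p : A × A, p.1 ∈ finiteCone τ ∧ p.2 ∈ finiteCone τ ∧ x = p.1 - p.2
  induction hx using Submodule.span_induction with
  | mem x h =>
    obtain ⟨a, ha, b, hb, h, -⟩ := hτ.exists_decomp_of_mem_A₁ h
    exact ⟨(a, b), ha, hb, h⟩
  | zero =>
    exact ⟨(0, 0), hτ.zero_mem_finiteCone hs, hτ.zero_mem_finiteCone hs, by simp⟩
  | add x y _ _ hx hy =>
    obtain ⟨p, hp1, hp2, hp⟩ := hx
    obtain ⟨q, hq1, hq2, hq⟩ := hy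
    refine ⟨(p.1 + q.1, p.2 + q.2), hτ.add_mem_finiteCone hp1 hq1,
      hτ.add_mem_finiteCone hp2 hq2, ?_⟩
    rw [hp, hq, add_sub_add_comm]
  | smul r x _ hx =>
    obtain ⟨p, hp1, hp2, hp⟩ := hx
    rcases le_total 0 r with hr | hr
    · exact ⟨(r • p.1, r • p.2), hτ.smul_mem_finiteCone hs hp1 hr,
        hτ.smul_mem_finiteCone hs hp2 hr, by rw [hp, smul_sub]⟩
    · have hr' : 0 ≤ -r := neg_nonneg.2 hr
      refine ⟨((-r) • p.2, (-r) • p.1), hτ.smul_mem_finiteCone hs hp2 hr',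
        hτ.smul_mem_finiteCone hs hp1 hr', ?_⟩
      rw [hp]
      module

theorem sub_eq_sub_of_sub_eq_sub {a b c d : A} (ha : a ∈ finiteCone τ) (hb : b ∈ finiteCone τ)
    (hc : c ∈ finiteCone τ) (hd : d ∈ finiteCone τ) (h : a - b = c - d) :
    (τ a).toReal - (τ b).toReal = (τ c).toReal - (τ d).toReal := by
  have h' : a + d = c + b := sub_eq_sub_iff_add_eq_add.1 h
  have := congrArg (fun z => (τ z).toReal) h'
  simp only [hτ.toReal_map_add ha hd, hτ.toReal_map_add hc hb] at this
  linarith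

/-- The trace extends to a linear functional on `A₁`, through differences of positive elements of
finite trace. -/
theorem exists_linear_extension (hs : IsSemifinite τ) :
    ∃ t : A₁Space τ →ₗ[ℝ] ℝ, ∀ x : A₁Space τ, ∀ a ∈ finiteCone τ, ∀ b ∈ finiteCone τ,
      A₁Space.incl τ x = a - b → t x = (τ a).toReal - (τ b).toReal := by
  choose p hp1 hp2 hp using hτ.exists_decomp hs
  set t : A₁Space τ → ℝ := fun x => (τ (p x).1).toReal - (τ (p x).2).toReal with ht
  have key : ∀ x : A₁Space τ, ∀ a ∈ finiteCone τ, ∀ b ∈ finiteCone τ,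
      A₁Space.incl τ x = a - b → t x = (τ a).toReal - (τ b).toReal := fun x a ha b hb h =>
    hτ.sub_eq_sub_of_sub_eq_sub (hp1 x) (hp2 x) ha hb ((hp x).symm.trans h)
  refine ⟨{ toFun := t, map_add' := fun x y => ?_, map_smul' := fun r x => ?_ }, key⟩
  · rw [key (x + y) _ (hτ.add_mem_finiteCone (hp1 x) (hp1 y)) _
      (hτ.add_mem_finiteCone (hp2 x) (hp2 y))
      (by rw [_root_.map_add, hp x, hp y, add_sub_add_comm]),
      hτ.toReal_map_add (hp1 x) (hp1 y), hτ.toReal_map_add (hp2 x) (hp2 y)]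
    simp only [ht]
    ring
  · rw [RingHom.id_apply, smul_eq_mul]
    rcases le_total 0 r with hr | hr
    · rw [key (r • x) _ (hτ.smul_mem_finiteCone hs (hp1 x) hr) _
        (hτ.smul_mem_finiteCone hs (hp2 x) hr) (by rw [_root_.map_smul, hp x, smul_sub]),
        hτ.toReal_map_smul hs (hp1 x) hr, hτ.toReal_map_smul hs (hp2 x) hr]
      ring
    · have hr' : 0 ≤ -r := neg_nonneg.2 hr
      rw [key (r • x) _ (hτ.smul_mem_finiteCone hs (hp2 x) hr') _
        (hτ.smul_mem_finiteCone hs (hp1 x) hr') (by rw [_root_.map_smul, hp x]; module),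
        hτ.toReal_map_smul hs (hp1 x) hr', hτ.toReal_map_smul hs (hp2 x) hr']
      ring

/-- On `L₁(A, τ)` there is a contractive functional which agrees with the norm on the positive
cone; in particular the norm is additive there. -/
theorem exists_functional_eq_norm (hs : IsSemifinite τ) :
    ∃ t : L1 τ →L[ℝ] ℝ, ∀ y ∈ L1.posCone τ, t y = ‖y‖ := by
  obtain ⟨t, ht⟩ := hτ.exists_linear_extension hs
  have hle : ∀ x : A₁Space τ, ‖t x‖ ≤ ‖x‖ := by
    have hmem : (normSeminorm ℝ ℝ).comp t ∈ minorants τ := fun x hx => by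
      obtain ⟨a, ha, b, hb, h, hm⟩ := hτ.exists_decomp_of_mem_A₁ hx
      change ‖t x‖ ≤ _
      rw [ht x a ha b hb h, hm, Real.norm_eq_abs]
      exact (abs_sub _ _).trans_eq (by simp)
    exact fun x => (isGreatest_oneNorm τ).2 hmem x
  set t₁ : A₁Space τ →L[ℝ] ℝ := t.mkContinuous 1 fun x => by simpa using hle x with ht₁
  set t₂ : L1 τ →L[ℝ] ℝ := t₁.extend (L1.of τ) with ht₂
  have hof : ∀ x, t₂ (L1.of τ x) = t x := fun x =>
    t₁.extend_eq (UniformSpace.Completion.denseRange_coe)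
      (UniformSpace.Completion.isUniformInducing_coe _) x
  refine ⟨t₂, fun y hy => ?_⟩
  refine closure_minimal (t := {y | t₂ y = ‖y‖}) ?_
    (isClosed_eq t₂.continuous continuous_norm) hy
  rintro _ ⟨x, hx1, hx, rfl⟩
  have hx2 : A₁Space.incl τ x ∈ finiteCone τ := ⟨hx, (mem_A₁_iff_of_mem_posCone hx).1 hx1⟩
  have h1 : t x = (τ (A₁Space.incl τ x)).toReal := by
    rw [ht x _ hx2 0 (hτ.zero_mem_finiteCone hs) (sub_zero _).symm, hτ.map_zero hs]; simp
  have hn : ‖L1.of τ x‖ = ‖x‖ := UniformSpace.Completion.norm_coe x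
  have h2 : ‖x‖ ≤ (τ (A₁Space.incl τ x)).toReal := by
    have := (isGreatest_oneNorm τ).1 x hx1
    rwa [modulus_eq_self hx] at this
  change t₂ (L1.of τ x) = ‖L1.of τ x‖
  rw [hof, hn]
  exact le_antisymm ((le_abs_self _).trans (hle x)) (h1 ▸ h2)

/-- The norm of an operator on `L₁(A, τ)` is determined on the positive cone. The seminorm
`x ↦ ‖P x‖ / c` on `A₁` is dominated by `τ(|x|) = τ(x⁺) + τ(x⁻)`, hence by `‖x‖₁`. -/
theorem opNorm_le_of_posCone {P : L1 τ →L[ℝ] L1 τ} {c : ℝ} (hc : 0 < c)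
    (h : ∀ y ∈ L1.posCone τ, ‖P y‖ ≤ c * ‖y‖) : ‖P‖ ≤ c := by
  have hcone : ∀ a (ha : a ∈ finiteCone τ), ∃ x : A₁Space τ, A₁Space.incl τ x = a ∧
      ‖P (L1.of τ x)‖ ≤ c * (τ a).toReal := by
    intro a ha
    have ha1 : a ∈ A₁ τ := (mem_A₁_iff_of_mem_posCone ha.1).2 ha.2
    refine ⟨(⟨a, Submodule.subset_span ha1⟩ : Submodule.span ℝ (A₁ τ)), rfl, ?_⟩
    set x : A₁Space τ := (⟨a, Submodule.subset_span ha1⟩ : Submodule.span ℝ (A₁ τ))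
    have hx : A₁Space.incl τ x = a := rfl
    refine (h _ (subset_closure ⟨x, ha1, ha.1, rfl⟩)).trans ?_
    have hn : ‖L1.of τ x‖ = ‖x‖ := UniformSpace.Completion.norm_coe x
    have h2 : ‖x‖ ≤ (τ (modulus a)).toReal := (isGreatest_oneNorm τ).1 x ha1
    rw [modulus_eq_self ha.1] at h2
    rw [hn]
    gcongr
  obtain ⟨k, hk⟩ : ∃ k : ℝ≥0, (k : ℝ) = c⁻¹ := ⟨⟨c⁻¹, inv_nonneg.2 hc.le⟩, rfl⟩
  have hmem : k •
      (normSeminorm ℝ (L1 τ)).comp (P.toLinearMap ∘ₗ (L1.of τ).toLinearMap) ∈ minorants τ := by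
    intro x hx
    obtain ⟨a, ha, b, hb, hab, hm⟩ := hτ.exists_decomp_of_mem_A₁ hx
    obtain ⟨y, rfl, hy⟩ := hcone a ha
    obtain ⟨z, rfl, hz⟩ := hcone b hb
    have hxyz : x = y - z := Subtype.ext hab
    change k * ‖P (L1.of τ x)‖ ≤ _
    rw [hk, hm, inv_mul_le_iff₀ hc, hxyz, map_sub, map_sub, mul_add]
    exact (norm_sub_le _ _).trans (add_le_add hy hz)
  have hA : ∀ x : A₁Space τ, ‖P (L1.of τ x)‖ ≤ c * ‖L1.of τ x‖ := fun x => by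
    have h1 : k * ‖P (L1.of τ x)‖ ≤ ‖x‖ := (isGreatest_oneNorm τ).2 hmem x
    have hn : ‖L1.of τ x‖ = ‖x‖ := UniformSpace.Completion.norm_coe x
    rwa [hn, ← inv_mul_le_iff₀ hc, ← hk]
  refine P.opNorm_le_bound hc.le fun y => ?_
  have hd : DenseRange (L1.of τ) := UniformSpace.Completion.denseRange_coe
  exact hd.induction_on (p := fun y => ‖P y‖ ≤ c * ‖y‖) y
    (isClosed_le (by fun_prop) (by fun_prop)) hA

theorem zero_mem_L1_posCone (hs : IsSemifinite τ) : (0 : L1 τ) ∈ L1.posCone τ := by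
  have h0 := hτ.zero_mem_finiteCone hs
  refine subset_closure ⟨0, ?_, ?_, _root_.map_zero _⟩
  · rw [_root_.map_zero]
    exact (mem_A₁_iff_of_mem_posCone h0.1).2 h0.2
  · rw [_root_.map_zero]
    exact h0.1

theorem add_mem_L1_posCone {x y : L1 τ} (hx : x ∈ L1.posCone τ) (hy : y ∈ L1.posCone τ) :
    x + y ∈ L1.posCone τ := by
  refine map_mem_closure₂ continuous_add hx hy ?_
  rintro _ ⟨a, ha1, ha, rfl⟩ _ ⟨b, hb1, hb, rfl⟩
  have hab : A₁Space.incl τ (a + b) ∈ finiteCone τ := by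
    rw [_root_.map_add]
    exact hτ.add_mem_finiteCone ⟨ha, (mem_A₁_iff_of_mem_posCone ha).1 ha1⟩
      ⟨hb, (mem_A₁_iff_of_mem_posCone hb).1 hb1⟩
  exact ⟨a + b, (mem_A₁_iff_of_mem_posCone hab.1).2 hab.2, hab.1, _root_.map_add _ _ _⟩

end IsTrace

end Trace

/-! ### Powers of a dominated pair of contractions -/

section Powers

variable {A : Type u} [JBAlgebra A] {τ : A → ℝ≥0∞}

theorem L1.zero_le_iff {x : L1 τ} : 0 ≤ x ↔ x ∈ L1.posCone τ := by
  change x - 0 ∈ _ ↔ _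
  rw [sub_zero]

theorem IsPositiveContraction.map_mem_posCone {T : L1 τ →L[ℝ] L1 τ} (hT : IsPositiveContraction T)
    {x : L1 τ} (hx : x ∈ L1.posCone τ) : T x ∈ L1.posCone τ :=
  L1.zero_le_iff.1 (hT.nonneg x (L1.zero_le_iff.2 hx))

theorem IsPositiveContraction.norm_map_le {T : L1 τ →L[ℝ] L1 τ} (hT : IsPositiveContraction T)
    (x : L1 τ) : ‖T x‖ ≤ ‖x‖ :=
  (T.le_of_opNorm_le hT.norm_le_one x).trans_eq (one_mul _)

theorem IsPositiveContraction.pow {T : L1 τ →L[ℝ] L1 τ} (hT : IsPositiveContraction T) (n : ℕ) :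
    (∀ x ∈ L1.posCone τ, (T ^ n) x ∈ L1.posCone τ) ∧ ∀ x, ‖(T ^ n) x‖ ≤ ‖x‖ := by
  induction n with
  | zero => simp
  | succ n ih =>
    simp only [pow_succ', mul_apply_eq_comp]
    exact ⟨fun x hx => hT.map_mem_posCone (ih.1 x hx),
      fun x => (hT.norm_map_le _).trans (ih.2 x)⟩

theorem pow_succ_sub_pow_succ_apply (S T : L1 τ →L[ℝ] L1 τ) (n : ℕ) (x : L1 τ) :
    (S ^ (n + 1) - T ^ (n + 1)) x = S ((S ^ n - T ^ n) x) + (S - T) ((T ^ n) x) := by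
  simp only [pow_succ', mul_apply_eq_comp, sub_apply, map_sub]
  abel

/-- If `S` dominates `T`, then `Sⁿ - Tⁿ` is positive. -/
theorem pow_sub_pow_mem_posCone (hτ : IsTrace τ) (hs : IsSemifinite τ)
    {T S : L1 τ →L[ℝ] L1 τ} (hT : IsPositiveContraction T) (hS : IsPositiveContraction S) (hTS : Dominates S T) (n : ℕ)
    {x : L1 τ} (hx : x ∈ L1.posCone τ) : (S ^ n - T ^ n) x ∈ L1.posCone τ := by
  induction n with
  | zero => simpa using hτ.zero_mem_L1_posCone hs
  | succ n ih =>
    rw [pow_succ_sub_pow_succ_apply]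
    exact hτ.add_mem_L1_posCone (hS.map_mem_posCone ih)
      (hTS _ (L1.zero_le_iff.2 ((hT.pow n).1 x hx)))

/-- With `d = ‖S - T‖` and `a = ‖Tⁿ x‖`, for positive `x` of norm `1` the vector
`(Sⁿ⁺¹ - Tⁿ⁺¹) x` has norm at most `‖Sⁿ - Tⁿ‖ + d a` and, as the norm is additive on the positive
cone, also at most `(1 - a) + d a`. The convex combination of these bounds with weights `1 - d` and
`d` does not involve `a`. -/
theorem norm_pow_succ_sub_pow_succ_le (hτ : IsTrace τ) (hs : IsSemifinite τ)
    {T S : L1 τ →L[ℝ] L1 τ} (hT : IsPositiveContraction T) (hS : IsPositiveContraction S)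
    (hTS : Dominates S T) (hd : ‖S - T‖ ≤ 1) {n : ℕ} {c : ℝ} (hc : 0 < c)
    (h : ‖S - T‖ + (1 - ‖S - T‖) * ‖S ^ n - T ^ n‖ ≤ c) : ‖S ^ (n + 1) - T ^ (n + 1)‖ ≤ c := by
  obtain ⟨t, ht⟩ := hτ.exists_functional_eq_norm hs
  refine hτ.opNorm_le_of_posCone hc fun x hx => le_trans ?_ (mul_le_mul_of_nonneg_right h
    (norm_nonneg x))
  set d := ‖S - T‖
  set a := ‖(T ^ n) x‖
  have h1 : ‖(S ^ (n + 1) - T ^ (n + 1)) x‖ ≤ ‖(S ^ n - T ^ n) x‖ + d * a := by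
    rw [pow_succ_sub_pow_succ_apply]
    exact (norm_add_le _ _).trans
      (add_le_add (hS.norm_map_le _) ((S - T).le_opNorm _))
  have h2 : ‖(S ^ n - T ^ n) x‖ ≤ ‖S ^ n - T ^ n‖ * ‖x‖ := (S ^ n - T ^ n).le_opNorm x
  have h3 : ‖(S ^ n - T ^ n) x‖ ≤ ‖x‖ - a := by
    rw [← ht _ (pow_sub_pow_mem_posCone hτ hs hT hS hTS n hx), sub_apply, map_sub,
      ht _ ((hS.pow n).1 x hx), ht _ ((hT.pow n).1 x hx)]
    exact sub_le_sub_right ((hS.pow n).2 x) _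
  have hd0 : 0 ≤ d := norm_nonneg _
  nlinarith [mul_le_mul_of_nonneg_left h2 (sub_nonneg.2 hd), mul_le_mul_of_nonneg_left h3 hd0]

end Powers

end JBAlgebra

theorem corollary3p4 {A : Type u} [JBAlgebra A] (hA : JBAlgebra.IsJBW A)
    (τ : A → ℝ≥0∞) (hτ : JBAlgebra.IsTrace τ) (hfaithful : JBAlgebra.IsFaithful τ)
    (hnormal : JBAlgebra.IsNormal τ) (hsemifinite : JBAlgebra.IsSemifinite τ)
    (T S : JBAlgebra.L1 τ →L[ℝ] JBAlgebra.L1 τ)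
    (hT : JBAlgebra.IsPositiveContraction T) (hS : JBAlgebra.IsPositiveContraction S)
    (hTS : JBAlgebra.Dominates S T) (h : ‖S - T‖ < 1) :
    ∀ n : ℕ, 1 ≤ n → ‖S ^ n - T ^ n‖ < 1 := by
  intro n hn
  induction n, hn using Nat.le_induction with
  | base => simpa using h
  | succ n hn ih =>
    -- The maximum with `1 / 2` keeps the bound positive.
    refine (JBAlgebra.norm_pow_succ_sub_pow_succ_le hτ hsemifinite hT hS hTS h.le
      (c := max (1 / 2) (‖S - T‖ + (1 - ‖S - T‖) * ‖S ^ n - T ^ n‖)) (by positivity)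
      (le_max_right _ _)).trans_lt (max_lt (by norm_num) ?_)
    nlinarith
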